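/- Let $n\ge 3$, let $e_1,\dots,e_n,f_1,\dots,f_n$ be the standard symplectic basis of $\mathbb{Z}^{2n}$, with the symplectic form $\langle\cdot,\cdot\rangle$ normalised by $\langle e_i,f_i\rangle=1$, and for $a\in\mathbb{Z}^{2n}$ let $T_a\in\mathrm{Sp}(2n,\mathbb{Z})$ be the transvection $T_a(x)=x+\langle a,x\rangle a$. Let $A$ and $B$ be the elements of $\mathrm{Sp}(2n,\mathbb{Z})$ that act on the plane with ordered basis $(e_1,f_1)$ by $$\begin{pmatrix}0&1\\-1&0\end{pmatrix}\quad\text{and}\quad\begin{pmatrix}0&-1\\1&1\end{pmatrix}$$ respectively, and fix all other basis vectors. (1) The set $\{T_aT_bT_a : a,b\in\mathbb{Z}^{2n},\ \langle a,b\rangle=1\}$ is the conjugacy class of $A$ in $\mathrm{Sp}(2n,\mathbb{Z})$; all its elements have order exactly $4$, and it generates $\mathrm{Sp}(2n,\mathbb{Z})$. (2) The set $\{T_aT_b : a,b\in\mathbb{Z}^{2n},\ \langle a,b\rangle=1\}$ is the conjugacy class of $B^{-1}$ in $\mathrm{Sp}(2n,\mathbb{Z})$; all its elements have order exactly $6$,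 and it generates $\mathrm{Sp}(2n,\mathbb{Z})$. Also $B$ has order $6$, and the conjugacy class of $B$ generates $\mathrm{Sp}(2n,\mathbb{Z})$. In particular, $\mathrm{Sp}(2n,\mathbb{Z})$ is generated by a single conjugacy class of torsion elements of order $4$, and also by a single conjugacy class of torsion elements of order $6$. -/

import Mathlib

open Matrix

/-- The integral symplectic group `Sp(2n, ℤ)`, with coordinates ordered as
`e₁, …, eₙ, f₁, …, fₙ`. -/
abbrev SpZ (n : ℕ) : Type := symplecticGroup (Fin n) ℤ

/-- The standard symplectic (intersection) form on `ℤ²ⁿ`, with `⟨eᵢ, fᵢ⟩ = 1`. -/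
def sympForm {n : ℕ} (x y : Fin n ⊕ Fin n → ℤ) : ℤ :=
  ∑ i, (x (Sum.inl i) * y (Sum.inr i) - x (Sum.inr i) * y (Sum.inl i))

theorem sympForm_eq_dotProduct {n : ℕ} (x y : Fin n ⊕ Fin n → ℤ) :
    sympForm x y = (J (Fin n) ℤ *ᵥ x) ⬝ᵥ y := by
  simp only [sympForm, J, fromBlocks_mulVec, dotProduct, Fintype.sum_sum_type, Sum.elim_inl,
    Sum.elim_inr, Finset.sum_sub_distrib]
  simp [neg_mulVec, Function.comp_def]
  ring

theorem sympForm_self {n : ℕ} (x : Fin n ⊕ Fin n → ℤ) : sympForm x x = 0 :=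
  Finset.sum_eq_zero fun _ _ => by ring

theorem J_mulVec_J_mulVec {n : ℕ} (x : Fin n ⊕ Fin n → ℤ) :
    J (Fin n) ℤ *ᵥ (J (Fin n) ℤ *ᵥ x) = -x := by
  rw [mulVec_mulVec, J_squared, neg_mulVec, one_mulVec]

/-- The symplectic transvection `x ↦ x + ⟨a, x⟩ a`, by which the Dehn twist along a simple closed
curve with homology class `a` acts on the first homology of a closed oriented surface. -/
def dehn {n : ℕ} (a : Fin n ⊕ Fin n → ℤ) : SpZ n :=
  ⟨1 + vecMulVec a (J (Fin n) ℤ *ᵥ a), by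
    have h1 : vecMulVec a (J (Fin n) ℤ *ᵥ a) * J (Fin n) ℤ = vecMulVec a a := by
      rw [vecMulVec_mul, ← mulVec_transpose, J_transpose, neg_mulVec, J_mulVec_J_mulVec, neg_neg]
    have h2 : J (Fin n) ℤ * vecMulVec (J (Fin n) ℤ *ᵥ a) a = -vecMulVec a a := by
      rw [mul_vecMulVec, J_mulVec_J_mulVec, neg_vecMulVec]
    have h3 : vecMulVec a a * vecMulVec (J (Fin n) ℤ *ᵥ a) a = 0 := by
      rw [vecMulVec_mul_vecMulVec, dotProduct_comm, ← sympForm_eq_dotProduct, sympForm_self]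
      simp
    rw [SymplecticGroup.mem_iff, transpose_add, transpose_one, transpose_vecMulVec, add_mul,
      one_mul, h1, mul_add, mul_one, add_mul, h2, h3]
    abel⟩

theorem dehn_mulVec {n : ℕ} (a x : Fin n ⊕ Fin n → ℤ) :
    (dehn a : Matrix (Fin n ⊕ Fin n) (Fin n ⊕ Fin n) ℤ) *ᵥ x = x + sympForm a x • a := by
  simp [dehn, add_mulVec, vecMulVec_mulVec, sympForm_eq_dotProduct]

/-- The actions on `ℤ²ⁿ` of the bifoil twists `t_α t_β t_α`: `α` and `β` run over pairs of simple
closed curves that cross once, so their classes run over the pairs with `⟨a, b⟩ = 1`. -/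
def bifoilClass (n : ℕ) : Set (SpZ n) :=
  {g | ∃ a b, sympForm a b = 1 ∧ g = dehn a * dehn b * dehn a}

/-- The actions on `ℤ²ⁿ` of the trefoil twists `t_α t_β`, with `α` and `β` as before. -/
def trefoilClass (n : ℕ) : Set (SpZ n) :=
  {g | ∃ a b, sympForm a b = 1 ∧ g = dehn a * dehn b}

/-- The symplectic matrix that acts as `M` on the plane spanned by `eᵢ, fᵢ` and fixes all other
basis vectors. -/
def onPlane {n : ℕ} (i : Fin n) (M : SpecialLinearGroup (Fin 2) ℤ) : SpZ n :=
  ⟨fromBlocks (diagonal (Function.update 1 i (M.1 0 0))) (diagonal (Function.update 0 i (M.1 0 1)))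
      (diagonal (Function.update 0 i (M.1 1 0))) (diagonal (Function.update 1 i (M.1 1 1))), by
    have h := M.2
    rw [det_fin_two] at h
    rw [SymplecticGroup.fromBlocks_mem_iff]
    simp only [diagonal_transpose, diagonal_mul_diagonal, diagonal_sub, ← diagonal_one]
    refine ⟨?_, ?_, ?_⟩ <;> congr 1 <;> funext j <;> by_cases hj : j = i
    all_goals first | (simp [hj]; done) | (subst hj; simp; linarith)⟩

def bifoilBlock : SpecialLinearGroup (Fin 2) ℤ :=
  ⟨!![0, 1; -1, 0], by simp [det_fin_two]⟩

def trefoilBlock : SpecialLinearGroup (Fin 2) ℤ :=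
  ⟨!![0, -1; 1, 1], by simp [det_fin_two]⟩

/-!
Both classes consist of products of transvections along hyperbolic pairs, that is, pairs `(a, b)`
with `⟨a, b⟩ = 1`. As `g T_a g⁻¹ = T_{g a}`, that each of them is a single conjugacy class amounts
to the transitivity of the symplectic group on hyperbolic pairs (`exists_map_hyperbolicPair`). This
is proved for the group generated by the transvections themselves, by a Euclidean algorithm on
`⟨a, f⟩`, and in any sublattice. Applied to the orthogonal complements of the first `k` standard
planes, it also shows that the transvections generate the symplectic group
(`transvectionSubgroup_top`). The orders are those of the two matrices in `SL(2, ℤ)`.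

For generation, consider the quotient by the normal subgroup that a class generates. The relations
coming from the hyperbolic pairs among `a`, `b` and `b - a` force `T_a` and `T_b` to have the same
image. For `n ≥ 3` there is an isotropic sublattice of rank `3`, hence a lantern relation
(`dehn_lantern`), a product of four transvections equal to a product of three. All seven have the
same image in the quotient, which is therefore trivial (`hom_eq_one_of_dehn_eq`).
-/

/-! ### The symplectic form and the action on the lattice -/

theorem sympForm_add_left {n : ℕ} (x y z : Fin n ⊕ Fin n → ℤ) :
    sympForm (x + y) z = sympForm x z + sympForm y z := by
  simp only [sympForm, Pi.add_apply, ← Finset.sum_add_distrib]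
  exact Finset.sum_congr rfl fun _ _ => by ring

theorem sympForm_smul_left {n : ℕ} (c : ℤ) (x y : Fin n ⊕ Fin n → ℤ) :
    sympForm (c • x) y = c * sympForm x y := by
  simp only [sympForm, Pi.smul_apply, smul_eq_mul, Finset.mul_sum]
  exact Finset.sum_congr rfl fun _ _ => by ring

theorem sympForm_swap {n : ℕ} (x y : Fin n ⊕ Fin n → ℤ) : sympForm x y = -sympForm y x := by
  simp only [sympForm, ← Finset.sum_neg_distrib]
  exact Finset.sum_congr rfl fun _ _ => by ring

theorem sympForm_neg_left {n : ℕ} (x y : Fin n ⊕ Fin n → ℤ) :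
    sympForm (-x) y = -sympForm x y := by
  simpa using sympForm_smul_left (-1) x y

theorem sympForm_sub_left {n : ℕ} (x y z : Fin n ⊕ Fin n → ℤ) :
    sympForm (x - y) z = sympForm x z - sympForm y z := by
  rw [sub_eq_add_neg, sympForm_add_left, sympForm_neg_left, sub_eq_add_neg]

theorem sympForm_add_right {n : ℕ} (x y z : Fin n ⊕ Fin n → ℤ) :
    sympForm x (y + z) = sympForm x y + sympForm x z := by
  rw [sympForm_swap, sympForm_add_left, sympForm_swap x y, sympForm_swap x z]
  ring

theorem sympForm_smul_right {n : ℕ} (c : ℤ) (x y : Fin n ⊕ Fin n → ℤ) :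
    sympForm x (c • y) = c * sympForm x y := by
  rw [sympForm_swap, sympForm_smul_left, sympForm_swap x y]
  ring

theorem sympForm_neg_right {n : ℕ} (x y : Fin n ⊕ Fin n → ℤ) :
    sympForm x (-y) = -sympForm x y := by
  simpa using sympForm_smul_right (-1) x y

theorem sympForm_sub_right {n : ℕ} (x y z : Fin n ⊕ Fin n → ℤ) :
    sympForm x (y - z) = sympForm x y - sympForm x z := by
  rw [sub_eq_add_neg, sympForm_add_right, sympForm_neg_right, sub_eq_add_neg]

theorem sympForm_mulVec {n : ℕ} (g : SpZ n) (x y : Fin n ⊕ Fin n → ℤ) :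
    sympForm (g.1 *ᵥ x) (g.1 *ᵥ y) = sympForm x y := by
  have hg : g.1ᵀ * J (Fin n) ℤ * g.1 = J (Fin n) ℤ := SymplecticGroup.mem_iff'.1 g.2
  rw [sympForm_eq_dotProduct, sympForm_eq_dotProduct, dotProduct_mulVec, ← mulVec_transpose,
    mulVec_mulVec, mulVec_mulVec, hg]

theorem SpZ.mul_mulVec {n : ℕ} (g h : SpZ n) (x : Fin n ⊕ Fin n → ℤ) :
    (g * h).1 *ᵥ x = g.1 *ᵥ (h.1 *ᵥ x) :=
  (mulVec_mulVec x g.1 h.1).symm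

theorem SpZ.one_mulVec {n : ℕ} (x : Fin n ⊕ Fin n → ℤ) : (1 : SpZ n).1 *ᵥ x = x :=
  Matrix.one_mulVec x

theorem SpZ.inv_mulVec_mulVec {n : ℕ} (g : SpZ n) (x : Fin n ⊕ Fin n → ℤ) :
    (g⁻¹).1 *ᵥ (g.1 *ᵥ x) = x := by
  rw [← SpZ.mul_mulVec, inv_mul_cancel, SpZ.one_mulVec]

theorem SpZ.mulVec_inv_mulVec {n : ℕ} (g : SpZ n) (x : Fin n ⊕ Fin n → ℤ) :
    g.1 *ᵥ ((g⁻¹).1 *ᵥ x) = x := by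
  rw [← SpZ.mul_mulVec, mul_inv_cancel, SpZ.one_mulVec]

theorem SpZ.ext_mulVec {n : ℕ} {g h : SpZ n} (H : ∀ x, g.1 *ᵥ x = h.1 *ᵥ x) : g = h :=
  Subtype.ext (Matrix.mulVec_injective (funext H))

theorem dehn_neg {n : ℕ} (a : Fin n ⊕ Fin n → ℤ) : dehn (-a) = dehn a :=
  SpZ.ext_mulVec fun x => by simp [dehn_mulVec, sympForm_neg_left]

theorem dehn_zpow_mulVec {n : ℕ} (a x : Fin n ⊕ Fin n → ℤ) (s : ℤ) :
    (dehn a ^ s).1 *ᵥ x = x + (s * sympForm a x) • a := by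
  have hinv (y : Fin n ⊕ Fin n → ℤ) : ((dehn a)⁻¹).1 *ᵥ y = y - sympForm a y • a := by
    rw [← SpZ.inv_mulVec_mulVec (dehn a) (y - sympForm a y • a), dehn_mulVec, sympForm_sub_right,
      sympForm_smul_right, sympForm_self]
    simp
  induction s generalizing x with
  | zero => simp
  | succ k ih =>
    rw [_root_.zpow_add_one, SpZ.mul_mulVec, ih, dehn_mulVec, sympForm_add_right,
      sympForm_smul_right, sympForm_self]
    module
  | pred k ih =>
    rw [_root_.zpow_sub_one, SpZ.mul_mulVec, ih, hinv, sympForm_sub_right, sympForm_smul_right,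
      sympForm_self]
    module

theorem conj_dehn {n : ℕ} (g : SpZ n) (a : Fin n ⊕ Fin n → ℤ) :
    g * dehn a * g⁻¹ = dehn (g.1 *ᵥ a) := by
  refine SpZ.ext_mulVec fun x => ?_
  have h : sympForm (g.1 *ᵥ a) x = sympForm a ((g⁻¹).1 *ᵥ x) := by
    rw [← sympForm_mulVec g a, SpZ.mulVec_inv_mulVec]
  rw [SpZ.mul_mulVec, SpZ.mul_mulVec, dehn_mulVec, dehn_mulVec, mulVec_add, mulVec_smul,
    SpZ.mulVec_inv_mulVec, h]

/-! ### Transitivity on hyperbolic pairs -/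

/-- The subgroup generated by the transvections along those vectors of `W` that pair to `1` with
some vector of `W`. -/
def transvectionSubgroup {n : ℕ} (W : AddSubgroup (Fin n ⊕ Fin n → ℤ)) : Subgroup (SpZ n) :=
  Subgroup.closure {g | ∃ v ∈ W, ∃ w ∈ W, sympForm v w = 1 ∧ g = dehn v}

theorem dehn_mem_transvectionSubgroup {n : ℕ} {W : AddSubgroup (Fin n ⊕ Fin n → ℤ)}
    {v w : Fin n ⊕ Fin n → ℤ} (hv : v ∈ W) (hw : w ∈ W) (h : sympForm v w = 1) :
    dehn v ∈ transvectionSubgroup W :=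
  Subgroup.subset_closure ⟨v, hv, w, hw, h, rfl⟩

theorem mulVec_mem_of_mem_transvectionSubgroup {n : ℕ} {W : AddSubgroup (Fin n ⊕ Fin n → ℤ)}
    {g : SpZ n} (hg : g ∈ transvectionSubgroup W) {x : Fin n ⊕ Fin n → ℤ} (hx : x ∈ W) :
    g.1 *ᵥ x ∈ W := by
  induction hg using Subgroup.closure_induction'' generalizing x with
  | one => rwa [SpZ.one_mulVec]
  | mem g hg =>
    obtain ⟨v, hv, -, -, -, rfl⟩ := hg
    rw [dehn_mulVec]
    exact W.add_mem hx (W.zsmul_mem hv _)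
  | inv_mem g hg =>
    obtain ⟨v, hv, -, -, -, rfl⟩ := hg
    rw [← _root_.zpow_neg_one, dehn_zpow_mulVec]
    exact W.add_mem hx (W.zsmul_mem hv _)
  | mul g h _ _ hg hh =>
    rw [SpZ.mul_mulVec]
    exact hg (hh hx)

theorem mulVec_eq_self_of_mem_transvectionSubgroup {n : ℕ}
    {W : AddSubgroup (Fin n ⊕ Fin n → ℤ)} {g : SpZ n} (hg : g ∈ transvectionSubgroup W)
    {x : Fin n ⊕ Fin n → ℤ} (hx : ∀ v ∈ W, sympForm v x = 0) : g.1 *ᵥ x = x := by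
  induction hg using Subgroup.closure_induction'' with
  | one => rw [SpZ.one_mulVec]
  | mem g hg =>
    obtain ⟨v, hv, -, -, -, rfl⟩ := hg
    simp [dehn_mulVec, hx v hv]
  | inv_mem g hg =>
    obtain ⟨v, hv, -, -, -, rfl⟩ := hg
    rw [← _root_.zpow_neg_one, dehn_zpow_mulVec]
    simp [hx v hv]
  | mul g h _ _ hg hh => rw [SpZ.mul_mulVec, hh, hg]

/-- The stabiliser of `e` acts transitively on the vectors pairing to `1` with `e`: a power of
`T_e` makes `⟨f, b⟩ = 1`, and then `T_{b - f}` carries `b` to `f`. -/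
theorem exists_fix_and_map_partner {n : ℕ} {W : AddSubgroup (Fin n ⊕ Fin n → ℤ)}
    {e f b : Fin n ⊕ Fin n → ℤ} (he : e ∈ W) (hf : f ∈ W) (hb : b ∈ W)
    (hef : sympForm e f = 1) (heb : sympForm e b = 1) :
    ∃ h ∈ transvectionSubgroup W, h.1 *ᵥ e = e ∧ h.1 *ᵥ b = f := by
  set c := b + (sympForm f b - 1) • e with hc
  have hcW : c ∈ W := W.add_mem hb (W.zsmul_mem he _)
  have hfe : sympForm f e = -1 := by rw [sympForm_swap, hef]
  have hfc : sympForm f c = 1 := by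
    rw [hc, sympForm_add_right, sympForm_smul_right, hfe]
    ring
  have hec : sympForm e c = 1 := by
    rw [hc, sympForm_add_right, sympForm_smul_right, heb, sympForm_self]
    ring
  have hdc : sympForm (c - f) c = -1 := by
    rw [sympForm_sub_left, sympForm_self, hfc]
    ring
  have hde : sympForm (c - f) e = 0 := by
    rw [sympForm_sub_left, sympForm_swap c, hec, hfe]
    ring
  refine ⟨dehn (c - f) * dehn e ^ (sympForm f b - 1), mul_mem
    (dehn_mem_transvectionSubgroup (w := -c) (W.sub_mem hcW hf) (W.neg_mem hcW) ?_)
    (zpow_mem (dehn_mem_transvectionSubgroup he hf hef) _), ?_, ?_⟩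
  · rw [sympForm_neg_right, hdc, neg_neg]
  · rw [SpZ.mul_mulVec, dehn_zpow_mulVec, sympForm_self, mul_zero, zero_smul, add_zero,
      dehn_mulVec, hde, zero_smul, add_zero]
  · rw [SpZ.mul_mulVec, dehn_zpow_mulVec, heb, mul_one, ← hc, dehn_mulVec, hdc]
    module

/-- The step that starts the Euclidean algorithm of `exists_sympForm_eq_one`. -/
theorem exists_sympForm_pos {n : ℕ} {W : AddSubgroup (Fin n ⊕ Fin n → ℤ)}
    {e f a b : Fin n ⊕ Fin n → ℤ} (he : e ∈ W) (hf : f ∈ W) (hb : b ∈ W)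
    (hef : sympForm e f = 1) (hab : sympForm a b = 1) :
    ∃ h ∈ transvectionSubgroup W, 0 < sympForm (h.1 *ᵥ a) f := by
  have key {v : Fin n ⊕ Fin n → ℤ} (hv : v ∈ W) (hvf : sympForm v f = 1)
      (hva : sympForm v a ≠ 0) :
      ∃ h ∈ transvectionSubgroup W, 0 < sympForm (h.1 *ᵥ a) f := by
    have (s : ℤ) : sympForm ((dehn v ^ s).1 *ᵥ a) f = sympForm a f + s * sympForm v a := by
      rw [dehn_zpow_mulVec, sympForm_add_left, sympForm_smul_left, hvf, mul_one]
    -- `p + (1 + p²) y² > 0` for all integers `p` and `y ≠ 0`.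
    refine ⟨dehn v ^ ((1 + sympForm a f ^ 2) * sympForm v a),
      zpow_mem (dehn_mem_transvectionSubgroup hv hf hvf) _, ?_⟩
    rw [this]
    have hy : 0 < sympForm v a ^ 2 := by positivity
    nlinarith [sq_nonneg (sympForm a f), sq_nonneg (sympForm a f + 1)]
  by_cases hea : sympForm e a = 0
  · refine key (v := b + (1 - sympForm b f) • e) (W.add_mem hb (W.zsmul_mem he _)) ?_ ?_
    · rw [sympForm_add_left, sympForm_smul_left, hef]
      ring
    · rw [sympForm_add_left, sympForm_smul_left, hea, sympForm_swap, hab]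
      norm_num
  · exact key he hef hea

/-- A Euclidean algorithm: among the values `m = ⟨h a, f⟩ > 0` with `h` in the group, take the
smallest. If `⟨v, f⟩ = 1`, then powers of `T_f` reduce `⟨v, h a⟩` modulo `m`, and `T_v⁻¹` subtracts
the remainder from `m`; so `m` divides every `⟨v, h a⟩`, hence divides `⟨a, b⟩ = 1`. -/
theorem exists_sympForm_eq_one {n : ℕ} {W : AddSubgroup (Fin n ⊕ Fin n → ℤ)}
    {e f a b : Fin n ⊕ Fin n → ℤ} (he : e ∈ W) (hf : f ∈ W) (hb : b ∈ W)
    (hef : sympForm e f = 1) (hab : sympForm a b = 1) :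
    ∃ h ∈ transvectionSubgroup W, sympForm (h.1 *ᵥ a) f = 1 := by
  classical
  have hne : ∃ m : ℕ, 0 < m ∧ ∃ h ∈ transvectionSubgroup W, sympForm (h.1 *ᵥ a) f = m := by
    obtain ⟨h, hh, hpos⟩ := exists_sympForm_pos he hf hb hef hab
    exact ⟨(sympForm (h.1 *ᵥ a) f).toNat, by omega, h, hh, by omega⟩
  obtain ⟨hm, h, hh, hha⟩ := Nat.find_spec hne
  set m := Nat.find hne
  have hfa : sympForm f (h.1 *ᵥ a) = -m := by rw [sympForm_swap, hha]
  have hdvd {v : Fin n ⊕ Fin n → ℤ} (hv : v ∈ W) (hvf : sympForm v f = 1) :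
      (m : ℤ) ∣ sympForm v (h.1 *ᵥ a) := by
    set y := sympForm v (h.1 *ᵥ a) with hy
    by_contra hnd
    have hr0 : y % m ≠ 0 := fun h0 => hnd (Int.dvd_of_emod_eq_zero h0)
    have hr1 : 0 ≤ y % m := Int.emod_nonneg _ (by omega)
    have hr2 : y % m < m := Int.emod_lt_of_pos _ (by omega)
    -- `(-f, v)` is a hyperbolic pair, and `T_{-f} = T_f`.
    have hF : sympForm (-f) v = 1 := by rw [sympForm_neg_left, sympForm_swap, hvf, neg_neg]
    have hfmem : dehn f ∈ transvectionSubgroup W := by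
      rw [← dehn_neg]
      exact dehn_mem_transvectionSubgroup (W.neg_mem hf) hv hF
    refine Nat.find_min hne (m := (m - y % m).toNat) (by omega) ⟨by omega,
      dehn v ^ (-1 : ℤ) * dehn f ^ (y / m) * h,
      mul_mem (mul_mem (zpow_mem (dehn_mem_transvectionSubgroup hv hf hvf) _)
        (zpow_mem hfmem _)) hh, ?_⟩
    rw [SpZ.mul_mulVec, SpZ.mul_mulVec, dehn_zpow_mulVec, dehn_zpow_mulVec]
    simp only [sympForm_add_left, sympForm_add_right, sympForm_smul_left, sympForm_smul_right,
      sympForm_self, hvf, hha, hfa, ← hy]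
    rw [Int.toNat_of_nonneg (by omega), Int.emod_def]
    ring
  have hdvd' {v : Fin n ⊕ Fin n → ℤ} (hv : v ∈ W) : (m : ℤ) ∣ sympForm v (h.1 *ᵥ a) := by
    -- `v + (1 - ⟨v, f⟩) e` and `e` both pair to `1` with `f`.
    have h1 := hdvd (v := v + (1 - sympForm v f) • e) (W.add_mem hv (W.zsmul_mem he _)) (by
      rw [sympForm_add_left, sympForm_smul_left, hef]
      ring)
    rw [sympForm_add_left, sympForm_smul_left] at h1
    exact (Int.dvd_add_left ((hdvd he hef).mul_left _)).1 h1
  have h1 := hdvd' (mulVec_mem_of_mem_transvectionSubgroup hh hb)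
  rw [sympForm_mulVec, sympForm_swap, hab, dvd_neg] at h1
  refine ⟨h, hh, hha.trans ?_⟩
  exact Int.eq_one_of_dvd_one (by omega) h1

/-- Transitivity on the hyperbolic pairs of `W`. -/
theorem exists_map_hyperbolicPair {n : ℕ} {W : AddSubgroup (Fin n ⊕ Fin n → ℤ)}
    {e f a b : Fin n ⊕ Fin n → ℤ} (he : e ∈ W) (hf : f ∈ W) (ha : a ∈ W) (hb : b ∈ W)
    (hef : sympForm e f = 1) (hab : sympForm a b = 1) :
    ∃ h ∈ transvectionSubgroup W, h.1 *ᵥ a = e ∧ h.1 *ᵥ b = f := by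
  obtain ⟨h₁, hh₁, h₁a⟩ := exists_sympForm_eq_one he hf hb hef hab
  have ha₁ := mulVec_mem_of_mem_transvectionSubgroup hh₁ ha
  -- With the roles of the two vectors exchanged, `(-f, e)` and `(-f, h₁ a)` are hyperbolic pairs.
  obtain ⟨h₂, hh₂, -, h₂a⟩ := exists_fix_and_map_partner (W.neg_mem hf) he ha₁
    (by rw [sympForm_neg_left, sympForm_swap, hef, neg_neg])
    (by rw [sympForm_neg_left, sympForm_swap, h₁a, neg_neg])
  have hmem := mul_mem hh₂ hh₁
  have h₂₁a : (h₂ * h₁).1 *ᵥ a = e := by rw [SpZ.mul_mulVec, h₂a]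
  obtain ⟨h₃, hh₃, h₃e, h₃b⟩ := exists_fix_and_map_partner he hf
    (mulVec_mem_of_mem_transvectionSubgroup hmem hb) hef
    (by rw [← hab, ← sympForm_mulVec (h₂ * h₁) a b, h₂₁a])
  exact ⟨h₃ * (h₂ * h₁), mul_mem hh₃ hmem, by rw [SpZ.mul_mulVec, h₂₁a, h₃e],
    by rw [SpZ.mul_mulVec, h₃b]⟩

/-! ### Generation by transvections -/

/-- The basis vector `eᵢ`. -/
def basisE {n : ℕ} (i : Fin n) : Fin n ⊕ Fin n → ℤ := Pi.single (Sum.inl i) 1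

/-- The basis vector `fᵢ`. -/
def basisF {n : ℕ} (i : Fin n) : Fin n ⊕ Fin n → ℤ := Pi.single (Sum.inr i) 1

theorem sympForm_basisE_left {n : ℕ} (i : Fin n) (x : Fin n ⊕ Fin n → ℤ) :
    sympForm (basisE i) x = x (Sum.inr i) := by
  simp [sympForm, basisE, Pi.single_apply]

theorem sympForm_basisF_left {n : ℕ} (i : Fin n) (x : Fin n ⊕ Fin n → ℤ) :
    sympForm (basisF i) x = -x (Sum.inl i) := by
  simp [sympForm, basisF, Pi.single_apply]

theorem sympForm_basisE_basisF {n : ℕ} (i j : Fin n) :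
    sympForm (basisE i) (basisF j) = if i = j then 1 else 0 := by
  simp [sympForm_basisE_left, basisF, Pi.single_apply]

theorem sympForm_basisE_basisE {n : ℕ} (i j : Fin n) :
    sympForm (basisE i) (basisE j) = 0 := by
  rw [sympForm_basisE_left]
  simp [basisE]

theorem sympForm_basisF_basisF {n : ℕ} (i j : Fin n) :
    sympForm (basisF i) (basisF j) = 0 := by
  rw [sympForm_basisF_left]
  simp [basisF]

theorem sympForm_basisF_basisE {n : ℕ} (i j : Fin n) :
    sympForm (basisF i) (basisE j) = if i = j then -1 else 0 := by
  rw [sympForm_swap, sympForm_basisE_basisF, apply_ite Neg.neg, neg_zero]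
  simp only [eq_comm]

theorem SpZ.ext_basis {n : ℕ} {g h : SpZ n} (hE : ∀ i, g.1 *ᵥ basisE i = h.1 *ᵥ basisE i)
    (hF : ∀ i, g.1 *ᵥ basisF i = h.1 *ᵥ basisF i) : g = h := by
  refine Subtype.ext (Matrix.ext_of_mulVec_single fun i => ?_)
  rcases i with i | i
  · exact hE i
  · exact hF i

/-- The orthogonal complement of the planes spanned by `eᵢ, fᵢ` for `i < k`. -/
def tailLattice (n k : ℕ) : AddSubgroup (Fin n ⊕ Fin n → ℤ) where
  carrier := {x | ∀ i : Fin n, (i : ℕ) < k → sympForm x (basisE i) = 0 ∧ sympForm x (basisF i) = 0}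
  zero_mem' i _ := by simp [sympForm]
  add_mem' hx hy i hi := by
    simp [sympForm_add_left, hx i hi, hy i hi]
  neg_mem' hx i hi := by
    simp [sympForm_neg_left, hx i hi]

theorem transvectionSubgroup_mono {n : ℕ} {W W' : AddSubgroup (Fin n ⊕ Fin n → ℤ)}
    (h : W ≤ W') : transvectionSubgroup W ≤ transvectionSubgroup W' :=
  Subgroup.closure_mono fun _ ⟨v, hv, w, hw, hvw, hg⟩ => ⟨v, h hv, w, h hw, hvw, hg⟩

/-- One standard plane after the other is restored to its place by transvections along vectors
orthogonal to the planes that are fixed already. -/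
theorem exists_fix_initial_planes {n : ℕ} (g : SpZ n) (k : ℕ) (hk : k ≤ n) :
    ∃ h ∈ transvectionSubgroup (⊤ : AddSubgroup (Fin n ⊕ Fin n → ℤ)),
      ∀ i : Fin n, (i : ℕ) < k →
        (h * g).1 *ᵥ basisE i = basisE i ∧ (h * g).1 *ᵥ basisF i = basisF i := by
  induction k with
  | zero => exact ⟨1, one_mem _, fun i hi => absurd hi (Nat.not_lt_zero _)⟩
  | succ k ih =>
    obtain ⟨h, hh, hfix⟩ := ih (by omega)
    let j : Fin n := ⟨k, by omega⟩
    have hj (i : Fin n) (hi : (i : ℕ) < k) : j ≠ i := fun hji => by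
      rw [← hji] at hi
      exact lt_irrefl _ hi
    have hE : basisE j ∈ tailLattice n k := fun i hi => by
      simp [sympForm_basisE_basisE, sympForm_basisE_basisF, hj i hi]
    have hF : basisF j ∈ tailLattice n k := fun i hi => by
      simp [sympForm_basisF_basisF, sympForm_swap (basisF j), sympForm_basisE_basisF,
        (hj i hi).symm]
    have hpres {x : Fin n ⊕ Fin n → ℤ} (hx : x ∈ tailLattice n k) :
        (h * g).1 *ᵥ x ∈ tailLattice n k := fun i hi => by
      obtain ⟨h1, h2⟩ := hfix i hi
      have h3 := sympForm_mulVec (h * g) x (basisE i)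
      have h4 := sympForm_mulVec (h * g) x (basisF i)
      rw [h1, (hx i hi).1] at h3
      rw [h2, (hx i hi).2] at h4
      exact ⟨h3, h4⟩
    have hjj : sympForm (basisE j) (basisF j) = 1 := by simp [sympForm_basisE_basisF]
    obtain ⟨h', hh', h'E, h'F⟩ := exists_map_hyperbolicPair hE hF (hpres hE) (hpres hF) hjj
      (by rw [sympForm_mulVec, hjj])
    refine ⟨h' * h, mul_mem (transvectionSubgroup_mono le_top hh') hh, fun i hi => ?_⟩
    rw [mul_assoc, SpZ.mul_mulVec, SpZ.mul_mulVec h']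
    rcases Nat.lt_succ_iff_lt_or_eq.1 hi with hi | hi
    · rw [(hfix i hi).1, (hfix i hi).2]
      exact ⟨mulVec_eq_self_of_mem_transvectionSubgroup hh' fun v hv => (hv i hi).1,
        mulVec_eq_self_of_mem_transvectionSubgroup hh' fun v hv => (hv i hi).2⟩
    · obtain rfl : i = j := Fin.ext hi
      exact ⟨h'E, h'F⟩

theorem transvectionSubgroup_top (n : ℕ) :
    transvectionSubgroup (⊤ : AddSubgroup (Fin n ⊕ Fin n → ℤ)) = ⊤ := by
  refine (Subgroup.eq_top_iff' _).2 fun g => ?_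
  obtain ⟨h, hh, hfix⟩ := exists_fix_initial_planes g n le_rfl
  have hg : h * g = 1 := SpZ.ext_basis
    (fun i => by rw [(hfix i i.2).1, SpZ.one_mulVec])
    (fun i => by rw [(hfix i i.2).2, SpZ.one_mulVec])
  rw [eq_inv_of_mul_eq_one_right hg]
  exact inv_mem hh

/-! ### The lantern relation and quotients of the symplectic group -/

/-- The image in the symplectic group of the lantern relation between Dehn twists. On an isotropic
sublattice `T_v - 1` is the square of `v` in the symmetric square, so this is the identity
`(a + b + c)² + a² + b² + c² = (a + b)² + (b + c)² + (a + c)²`. -/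
theorem dehn_lantern {n : ℕ} {a b c : Fin n ⊕ Fin n → ℤ} (hab : sympForm a b = 0)
    (hac : sympForm a c = 0) (hbc : sympForm b c = 0) :
    dehn (a + b + c) * dehn a * dehn b * dehn c =
      dehn (a + b) * dehn (b + c) * dehn (a + c) := by
  have hba : sympForm b a = 0 := by rw [sympForm_swap, hab, neg_zero]
  have hca : sympForm c a = 0 := by rw [sympForm_swap, hac, neg_zero]
  have hcb : sympForm c b = 0 := by rw [sympForm_swap, hbc, neg_zero]
  refine SpZ.ext_mulVec fun x => ?_
  simp only [SpZ.mul_mulVec, dehn_mulVec, sympForm_add_left, sympForm_add_right,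
    sympForm_smul_right, sympForm_self, hab, hac, hbc, hba, hca, hcb]
  module

/-- A homomorphism that takes equal values on the two transvections of each hyperbolic pair is
trivial once `n ≥ 3`: the seven transvections of a lantern relation then have the same image `t`,
so that `t⁴ = t³`. -/
theorem hom_eq_one_of_dehn_eq {n : ℕ} (hn : 3 ≤ n) {Q : Type*} [Group Q] (φ : SpZ n →* Q)
    (hφ : ∀ a b, sympForm a b = 1 → φ (dehn a) = φ (dehn b)) (g : SpZ n) : φ g = 1 := by
  let i : Fin n := ⟨0, by omega⟩
  let j : Fin n := ⟨1, by omega⟩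
  let k : Fin n := ⟨2, by omega⟩
  have hij : i ≠ j := by simp [i, j]
  have hik : i ≠ k := by simp [i, k]
  have hjk : j ≠ k := by simp [j, k]
  have hlantern := congrArg φ (dehn_lantern (sympForm_basisE_basisE i j)
    (sympForm_basisE_basisE i k) (sympForm_basisE_basisE j k))
  have key (v : Fin n ⊕ Fin n → ℤ) (l : Fin n) (hv : sympForm v (basisF l) = 1) :
      φ (dehn v) = φ (dehn (basisE l)) :=
    (hφ _ _ hv).trans (hφ _ _ (by simp [sympForm_basisE_basisF])).symm
  have h1 := key (basisE i + basisE j + basisE k) i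
    (by simp [sympForm_add_left, sympForm_basisE_basisF, hij.symm, hik.symm])
  have h2 := key (basisE i + basisE j) i
    (by simp [sympForm_add_left, sympForm_basisE_basisF, hij.symm])
  have h3 := key (basisE i + basisE j) j
    (by simp [sympForm_add_left, sympForm_basisE_basisF, hij])
  have h4 := key (basisE i + basisE k) i
    (by simp [sympForm_add_left, sympForm_basisE_basisF, hik.symm])
  have h5 := key (basisE i + basisE k) k
    (by simp [sympForm_add_left, sympForm_basisE_basisF, hik])
  have h6 := key (basisE j + basisE k) j
    (by simp [sympForm_add_left, sympForm_basisE_basisF, hjk.symm])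
  have ht : φ (dehn (basisE i)) = 1 := by
    simp only [map_mul] at hlantern
    rw [h1, h6, ← h3, ← h5, h4, h2] at hlantern
    simpa [mul_assoc] using hlantern
  have hg : g ∈ transvectionSubgroup (⊤ : AddSubgroup (Fin n ⊕ Fin n → ℤ)) := by
    rw [transvectionSubgroup_top]
    trivial
  have hle : transvectionSubgroup (⊤ : AddSubgroup (Fin n ⊕ Fin n → ℤ)) ≤ φ.ker := by
    refine (Subgroup.closure_le _).2 ?_
    rintro _ ⟨v, -, w, -, hvw, rfl⟩
    obtain ⟨h, -, hv, -⟩ := exists_map_hyperbolicPair (W := ⊤) (AddSubgroup.mem_top v)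
      (AddSubgroup.mem_top w) (AddSubgroup.mem_top (basisE i)) (AddSubgroup.mem_top (basisF i))
      hvw (by simp [sympForm_basisE_basisF])
    rw [SetLike.mem_coe, MonoidHom.mem_ker, ← hv, ← conj_dehn, map_mul, map_mul, ht, mul_one,
      ← map_mul, mul_inv_cancel, map_one]
  exact hle hg

/-- A conjugacy class generates the whole group as soon as every homomorphism that kills it takes
equal values on the two transvections of each hyperbolic pair. -/
theorem closure_conjugatesOf_eq_top {n : ℕ} (hn : 3 ≤ n) (g : SpZ n)
    (H : ∀ {Q : Type} [Group Q] (φ : SpZ n →* Q), (∀ x ∈ conjugatesOf g, φ x = 1) →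
      ∀ a b, sympForm a b = 1 → φ (dehn a) = φ (dehn b)) :
    Subgroup.closure (conjugatesOf g) = ⊤ := by
  have hN : Subgroup.closure (conjugatesOf g) = Subgroup.normalClosure {g} := by
    simp [Subgroup.normalClosure, Group.conjugatesOfSet]
  rw [hN]
  refine (Subgroup.eq_top_iff' _).2 fun x => ?_
  rw [← QuotientGroup.eq_one_iff]
  refine hom_eq_one_of_dehn_eq hn (QuotientGroup.mk' (Subgroup.normalClosure {g}))
    (H _ fun y hy => ?_) x
  rw [QuotientGroup.mk'_apply, QuotientGroup.eq_one_iff, ← hN]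
  exact Subgroup.subset_closure hy

/-! ### The twist classes -/

theorem onPlane_mulVec_basisE {n : ℕ} (i j : Fin n) (M : SpecialLinearGroup (Fin 2) ℤ) :
    (onPlane i M).1 *ᵥ basisE j =
      if j = i then M.1 0 0 • basisE i + M.1 1 0 • basisF i else basisE j := by
  rw [basisE, mulVec_single_one]
  ext l
  rcases l with l | l <;> by_cases hj : j = i <;> by_cases hl : l = i <;> by_cases hlj : l = j <;>
    simp_all [onPlane, basisE, basisF]

theorem onPlane_mulVec_basisF {n : ℕ} (i j : Fin n) (M : SpecialLinearGroup (Fin 2) ℤ) :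
    (onPlane i M).1 *ᵥ basisF j =
      if j = i then M.1 0 1 • basisE i + M.1 1 1 • basisF i else basisF j := by
  rw [basisF, mulVec_single_one]
  ext l
  rcases l with l | l <;> by_cases hj : j = i <;> by_cases hl : l = i <;> by_cases hlj : l = j <;>
    simp_all [onPlane, basisE, basisF]

/-- `onPlane i` as a homomorphism from `SL(2, ℤ)`. -/
def onPlaneHom {n : ℕ} (i : Fin n) : SpecialLinearGroup (Fin 2) ℤ →* SpZ n :=
  MonoidHom.mk' (onPlane i) fun M N => by
    have hMN (r s : Fin 2) : (M * N).1 r s = M.1 r 0 * N.1 0 s + M.1 r 1 * N.1 1 s := by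
      simp [mul_apply]
    refine SpZ.ext_basis (fun j => ?_) (fun j => ?_)
    · by_cases hj : j = i
      · simp only [SpZ.mul_mulVec, onPlane_mulVec_basisE, onPlane_mulVec_basisF, mulVec_add,
          mulVec_smul, hj, if_true, hMN]
        module
      · simp only [SpZ.mul_mulVec, onPlane_mulVec_basisE, hj, if_false]
    · by_cases hj : j = i
      · simp only [SpZ.mul_mulVec, onPlane_mulVec_basisE, onPlane_mulVec_basisF, mulVec_add,
          mulVec_smul, hj, if_true, hMN]
        module
      · simp only [SpZ.mul_mulVec, onPlane_mulVec_basisF, hj, if_false]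

theorem onPlaneHom_injective {n : ℕ} (i : Fin n) : Function.Injective (onPlaneHom i) := by
  intro M N h
  have hE := congrArg (fun g : SpZ n => g.1 *ᵥ basisE i) h
  have hF := congrArg (fun g : SpZ n => g.1 *ᵥ basisF i) h
  simp only [onPlaneHom, MonoidHom.mk'_apply, onPlane_mulVec_basisE, onPlane_mulVec_basisF,
    if_true] at hE hF
  have h00 := congrFun hE (Sum.inl i)
  have h10 := congrFun hE (Sum.inr i)
  have h01 := congrFun hF (Sum.inl i)
  have h11 := congrFun hF (Sum.inr i)
  simp [basisE, basisF] at h00 h10 h01 h11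
  ext r s
  fin_cases r <;> fin_cases s <;> assumption

theorem orderOf_onPlane {n : ℕ} (i : Fin n) (M : SpecialLinearGroup (Fin 2) ℤ) :
    orderOf (onPlane i M) = orderOf M :=
  orderOf_injective (onPlaneHom i) (onPlaneHom_injective i) M

theorem orderOf_bifoilBlock : orderOf bifoilBlock = 4 := by
  have : orderOf bifoilBlock = 2 ^ (1 + 1) := orderOf_eq_prime_pow (by decide) (by decide)
  simpa using this

theorem orderOf_trefoilBlock : orderOf trefoilBlock = 6 := by
  refine orderOf_eq_of_pow_and_pow_div_prime (by norm_num) (by decide) fun p hp hdvd => ?_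
  have hp' : p = 2 ∨ p = 3 := by
    have hle := Nat.le_of_dvd (by norm_num) hdvd
    interval_cases p <;> revert hp hdvd <;> decide
  rcases hp' with rfl | rfl <;> decide

theorem onPlane_bifoilBlock {n : ℕ} (i : Fin n) :
    onPlane i bifoilBlock = dehn (basisE i) * dehn (basisF i) * dehn (basisE i) := by
  refine SpZ.ext_basis (fun j => ?_) (fun j => ?_) <;>
    simp only [SpZ.mul_mulVec, onPlane_mulVec_basisE, onPlane_mulVec_basisF, dehn_mulVec,
      sympForm_add_right, sympForm_smul_right, sympForm_basisE_basisE, sympForm_basisE_basisF,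
      sympForm_basisF_basisF, sympForm_basisF_basisE, eq_comm (a := i)] <;>
    split_ifs with hj <;> simp [bifoilBlock, hj]

theorem onPlane_trefoilBlock_inv {n : ℕ} (i : Fin n) :
    (onPlane i trefoilBlock)⁻¹ = dehn (basisF i) * dehn (basisE i) := by
  refine inv_eq_of_mul_eq_one_left (SpZ.ext_basis (fun j => ?_) (fun j => ?_)) <;>
    simp only [SpZ.mul_mulVec, onPlane_mulVec_basisE, onPlane_mulVec_basisF, dehn_mulVec,
      SpZ.one_mulVec] <;>
    split_ifs with hj <;>
    simp only [sympForm_add_right, sympForm_smul_right, sympForm_basisE_basisE,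
      sympForm_basisE_basisF, sympForm_basisF_basisF, sympForm_basisF_basisE, eq_comm (a := i)] <;>
    simp [trefoilBlock, hj]

theorem bifoilClass_eq {n : ℕ} (i : Fin n) :
    bifoilClass n = conjugatesOf (onPlane i bifoilBlock) := by
  have hEF : sympForm (basisE i) (basisF i) = 1 := by simp [sympForm_basisE_basisF]
  have hconj (g : SpZ n) (a b : Fin n ⊕ Fin n → ℤ) : g * (dehn a * dehn b * dehn a) * g⁻¹ =
      dehn (g.1 *ᵥ a) * dehn (g.1 *ᵥ b) * dehn (g.1 *ᵥ a) := by
    simp only [← conj_dehn]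
    group
  rw [onPlane_bifoilBlock]
  ext g
  rw [conjugatesOf, Set.mem_ofPred_eq, isConj_iff]
  constructor
  · rintro ⟨a, b, hab, rfl⟩
    obtain ⟨h, -, hE, hF⟩ := exists_map_hyperbolicPair (W := ⊤) trivial trivial trivial trivial
      hab hEF
    exact ⟨h, by rw [hconj, hE, hF]⟩
  · rintro ⟨h, rfl⟩
    exact ⟨_, _, (sympForm_mulVec h _ _).trans hEF, hconj _ _ _⟩

theorem trefoilClass_eq {n : ℕ} (i : Fin n) :
    trefoilClass n = conjugatesOf (onPlane i trefoilBlock)⁻¹ := by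
  -- `T_{-e} = T_e`, and `(f, -e)` is a hyperbolic pair.
  have hFE : sympForm (basisF i) (-basisE i) = 1 := by
    rw [sympForm_swap, sympForm_neg_left, neg_neg]
    simp [sympForm_basisE_basisF]
  have hconj (g : SpZ n) (a b : Fin n ⊕ Fin n → ℤ) : g * (dehn a * dehn b) * g⁻¹ =
      dehn (g.1 *ᵥ a) * dehn (g.1 *ᵥ b) := by
    simp only [← conj_dehn]
    group
  rw [onPlane_trefoilBlock_inv, ← dehn_neg (basisE i)]
  ext g
  rw [conjugatesOf, Set.mem_ofPred_eq, isConj_iff]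
  constructor
  · rintro ⟨a, b, hab, rfl⟩
    obtain ⟨h, -, hF, hE⟩ := exists_map_hyperbolicPair (W := ⊤) trivial trivial trivial trivial
      hab hFE
    exact ⟨h, by rw [hconj, hE, hF]⟩
  · rintro ⟨h, rfl⟩
    exact ⟨_, _, (sympForm_mulVec h _ _).trans hFE, hconj _ _ _⟩

theorem orderOf_eq_of_mem_conjugatesOf {G : Type*} [Group G] {g h : G}
    (hh : h ∈ conjugatesOf g) : orderOf h = orderOf g := by
  obtain ⟨c, rfl⟩ := isConj_iff.1 hh
  exact orderOf_injective (MulAut.conj c).toMonoidHom (MulAut.conj c).injective g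

/-- Given a hyperbolic pair `(a, b)`, the pairs `(b, -a)`, `(a, b - a)` and `(b, b - a)` are
hyperbolic too; the relations they give identify the images of `T_a` and `T_b`. -/
theorem closure_bifoilClass {n : ℕ} (hn : 3 ≤ n) : Subgroup.closure (bifoilClass n) = ⊤ := by
  have i : Fin n := ⟨0, by omega⟩
  rw [bifoilClass_eq i]
  refine closure_conjugatesOf_eq_top hn _ fun {Q} _ φ hφ a b hab => ?_
  rw [← bifoilClass_eq i] at hφ
  have hrel (x y) (hxy : sympForm x y = 1) : φ (dehn x) * φ (dehn y) * φ (dehn x) = 1 := by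
    simpa using hφ _ ⟨x, y, hxy, rfl⟩
  have hba : sympForm b a = -1 := by rw [sympForm_swap, hab]
  have h1 := hrel a b hab
  have h2 := hrel b (-a) (by rw [sympForm_neg_right, hba, neg_neg])
  have h3 := hrel a (b - a) (by rw [sympForm_sub_right, sympForm_self, hab, sub_zero])
  have h4 := hrel b (b - a) (by rw [sympForm_sub_right, sympForm_self, hba]; norm_num)
  rw [dehn_neg] at h2
  have h5 : φ (dehn b) = φ (dehn (b - a)) := mul_left_cancel (mul_right_cancel (h1.trans h3.symm))
  rw [← h5] at h4
  exact mul_left_cancel (mul_right_cancel (h2.trans h4.symm))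

/-- Given a hyperbolic pair `(a, b)`, the pairs `(a, b - a)` and `(b, b - a)` are hyperbolic too, so
the images of `T_a` and `T_b` are both inverse to that of `T_{b - a}`. -/
theorem closure_trefoilClass {n : ℕ} (hn : 3 ≤ n) : Subgroup.closure (trefoilClass n) = ⊤ := by
  have i : Fin n := ⟨0, by omega⟩
  rw [trefoilClass_eq i]
  refine closure_conjugatesOf_eq_top hn _ fun {Q} _ φ hφ a b hab => ?_
  rw [← trefoilClass_eq i] at hφ
  have hrel (x y) (hxy : sympForm x y = 1) : φ (dehn x) * φ (dehn y) = 1 := by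
    simpa using hφ _ ⟨x, y, hxy, rfl⟩
  have hba : sympForm b a = -1 := by rw [sympForm_swap, hab]
  have h1 := hrel a (b - a) (by rw [sympForm_sub_right, sympForm_self, hab, sub_zero])
  have h2 := hrel b (b - a) (by rw [sympForm_sub_right, sympForm_self, hba]; norm_num)
  exact mul_right_cancel (h1.trans h2.symm)

theorem mainTheorem9 (n : ℕ) (hn : 3 ≤ n) :
    (bifoilClass n = conjugatesOf (onPlane (⟨0, by omega⟩ : Fin n) bifoilBlock) ∧
      (∀ g ∈ bifoilClass n, orderOf g = 4) ∧
      Subgroup.closure (bifoilClass n) = ⊤) ∧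
    (trefoilClass n = conjugatesOf (onPlane (⟨0, by omega⟩ : Fin n) trefoilBlock)⁻¹ ∧
      (∀ g ∈ trefoilClass n, orderOf g = 6) ∧
      Subgroup.closure (trefoilClass n) = ⊤) ∧
    (orderOf (onPlane (⟨0, by omega⟩ : Fin n) trefoilBlock) = 6 ∧
      Subgroup.closure (conjugatesOf (onPlane (⟨0, by omega⟩ : Fin n) trefoilBlock)) = ⊤) := by
  refine ⟨⟨bifoilClass_eq _, fun g hg => ?_, closure_bifoilClass hn⟩,
    ⟨trefoilClass_eq _, fun g hg => ?_, closure_trefoilClass hn⟩, ?_, ?_⟩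
  · rw [bifoilClass_eq ⟨0, by omega⟩] at hg
    rw [orderOf_eq_of_mem_conjugatesOf hg, orderOf_onPlane, orderOf_bifoilBlock]
  · rw [trefoilClass_eq ⟨0, by omega⟩] at hg
    rw [orderOf_eq_of_mem_conjugatesOf hg, orderOf_inv, orderOf_onPlane, orderOf_trefoilBlock]
  · rw [orderOf_onPlane, orderOf_trefoilBlock]
  · -- The conjugates of an element are the inverses of the conjugates of its inverse.
    refine top_le_iff.1 ((closure_trefoilClass hn).symm.le.trans ((Subgroup.closure_le _).2 ?_))
    rw [trefoilClass_eq ⟨0, by omega⟩]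
    intro g hg
    obtain ⟨c, rfl⟩ := isConj_iff.1 hg
    rw [← conj_inv]
    exact inv_mem (Subgroup.subset_closure (isConj_iff.2 ⟨c, rfl⟩))
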